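/- **Theorem (Selective overdamping).** Let $\alpha,\eta,\theta,R$ be real $N\times N$ matrices with $\alpha^{T}=\alpha>0$, $\eta^{T}=\eta\ge 0$, $\theta^{T}=-\theta$, $R^{T}=R\ge 0$, and $N_R:=\operatorname{rank}R>0$. Put $K_p=\sqrt{\alpha}^{\,-1}$, $\Phi=\sqrt{\eta}\,K_p^{T}$ and $$A(\beta)=\Omega-\mathrm i\beta B,\qquad \Omega=\begin{bmatrix}-2\mathrm i K_p\theta K_p^{T} & -\mathrm i\Phi^{T}\\ \mathrm i\Phi & 0\end{bmatrix},\qquad B=\begin{bmatrix}K_pRK_p^{T}&0\\0&0\end{bmatrix}.$$ Assume the generic condition: the eigenvalues $b_1,\dots,b_{N_R}$ of the restriction of $B$ to $\operatorname{Ran}B$, counted with multiplicity (equivalently, the nonzero eigenvalues of $\alpha^{-1}R$), are pairwise distinct. Call functions $\zeta_1,\dots,\zeta_{2N}$ of $\beta$ an *eigenvalue family* if for all sufficiently large $\beta$ the numbers $\zeta_1(\beta),\dots,\zeta_{2N}(\beta)$ are the eigenvalues of $A(\beta)$ counted with algebraic multiplicity, $|\zeta_j(\beta)|\to\infty$ as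 $\beta\to\infty$ for $1\le j\le N_R$ (high-loss), and $\zeta_j(\beta)$ has a finite limit as $\beta\to\infty$ for $N_R+1\le j\le 2N$ (low-loss). Then eigenvalue families exist, and for every eigenvalue family the following holds. 1. For all sufficiently large $\beta$, $\operatorname{Re}\zeta_j(\beta)=0$ for $1\le j\le N_R$; that is, all high-loss eigenvalues are overdamped. 2. Suppose in addition that $\operatorname{Ker}R\cap\operatorname{Ker}\eta=\{0\}$. Then the family can be reindexed, as an eigenvalue family, so that $\lim_{\beta\to\infty}\zeta_j(\beta)=0$ for $N_R+1\le j\le 2N_R$ and $\lim_{\beta\to\infty}\zeta_j(\beta)=\rho_j\neq 0$ for $2N_R+1\le j\le 2N$; and for every such indexing, $\operatorname{Re}\zeta_j(\beta)\ne 0$ for $2N_R+1\le j\le 2N$ and all sufficiently large $\beta$, while $\lim_{\beta\to\infty}\operatorname{Re}\zeta_j(\beta)=0$ for $N_R+1\le j\le 2N_R$. -/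

import Mathlib

open Filter Topology Polynomial
open scoped MatrixOrder

namespace SelectiveOverdamping

noncomputable section

/-- Real matrices regarded as complex matrices. -/
def toC {m n : Type*} (M : Matrix m n ℝ) : Matrix m n ℂ := M.map (fun x : ℝ => (x : ℂ))

/-- `K_p = (√α)⁻¹`, with `√α` the positive square root of `α`. -/
def Kp {N : ℕ} (α : Matrix (Fin N) (Fin N) ℝ) : Matrix (Fin N) (Fin N) ℝ := (CFC.sqrt α)⁻¹

/-- `K_q = √η`, the positive semidefinite square root of `η`. -/
def Kq {N : ℕ} (η : Matrix (Fin N) (Fin N) ℝ) : Matrix (Fin N) (Fin N) ℝ := CFC.sqrt η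

/-- `Φ = K_q K_pᵀ`. -/
def Phi {N : ℕ} (α η : Matrix (Fin N) (Fin N) ℝ) : Matrix (Fin N) (Fin N) ℝ :=
  Kq η * (Kp α).transpose

/-- The frequency operator `Ω = [[-2i K_p θ K_pᵀ, -i Φᵀ], [i Φ, 0]]`. -/
def Omega {N : ℕ} (α η θ : Matrix (Fin N) (Fin N) ℝ) :
    Matrix (Fin N ⊕ Fin N) (Fin N ⊕ Fin N) ℂ :=
  Matrix.fromBlocks
    ((-(2 * Complex.I)) • toC (Kp α * θ * (Kp α).transpose))
    ((-Complex.I) • toC (Phi α η).transpose)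
    (Complex.I • toC (Phi α η))
    0

/-- The dissipation operator `B = [[K_p R K_pᵀ, 0], [0, 0]]`. -/
def lossB {N : ℕ} (α R : Matrix (Fin N) (Fin N) ℝ) :
    Matrix (Fin N ⊕ Fin N) (Fin N ⊕ Fin N) ℂ :=
  Matrix.fromBlocks (toC (Kp α * R * (Kp α).transpose)) 0 0 0

/-- The system operator `A(β) = Ω - i β B`. -/
def systemOp {N : ℕ} (α η θ R : Matrix (Fin N) (Fin N) ℝ) (β : ℝ) :
    Matrix (Fin N ⊕ Fin N) (Fin N ⊕ Fin N) ℂ :=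
  Omega α η θ - (Complex.I * (β : ℂ)) • lossB α R

/-- The loss subspace `H_B = Ran B`. -/
def lossSubspace {N : ℕ} (α R : Matrix (Fin N) (Fin N) ℝ) :
    Submodule ℂ (Fin N ⊕ Fin N → ℂ) :=
  LinearMap.range (lossB α R).mulVecLin

/-- The operator `B₂ : H_B → H_B` induced by `B` on the loss subspace. -/
def lossB2 {N : ℕ} (α R : Matrix (Fin N) (Fin N) ℝ) :
    lossSubspace α R →ₗ[ℂ] lossSubspace α R :=
  (lossB α R).mulVecLin.restrict (fun x _ => LinearMap.mem_range_self _ x)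

/-- The generic condition: the eigenvalues `b₁, …, b_{N_R}` of `B₂`, listed with multiplicity
(these are the nonzero eigenvalues of `α⁻¹ R`), are pairwise distinct. -/
def GenericCondition {N : ℕ} (α R : Matrix (Fin N) (Fin N) ℝ) : Prop :=
  (lossB2 α R).charpoly.roots.Nodup

/-- A function of the loss parameter is of high-loss type if its modulus tends to infinity. -/
def IsHighLoss (z : ℝ → ℂ) : Prop := Tendsto (fun β => ‖z β‖) atTop atTop

/-- A function of the loss parameter is of low-loss type if it has a finite limit. -/
def IsLowLoss (z : ℝ → ℂ) : Prop := ∃ ρ : ℂ, Tendsto z atTop (𝓝 ρ)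

/-- `ζ₁, …, ζ_{2N}` are eigenvalue functions of `A`: for all large `β` the numbers `ζ_j(β)` are
the eigenvalues of `A(β)` counted with (algebraic) multiplicity; the first `r` of these functions
are of high-loss type and the others are of low-loss type. -/
structure IsEigenvalueFamily {N : ℕ} (A : ℝ → Matrix (Fin N ⊕ Fin N) (Fin N ⊕ Fin N) ℂ) (r : ℕ)
    (ζ : Fin (2 * N) → ℝ → ℂ) : Prop where
  charpoly_eq : ∀ᶠ β in atTop, (A β).charpoly = ∏ j, (X - C (ζ j β))
  high : ∀ j : Fin (2 * N), (j : ℕ) < r → IsHighLoss (ζ j)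
  low : ∀ j : Fin (2 * N), r ≤ (j : ℕ) → IsLowLoss (ζ j)

/-- The refined indexing of the low-loss eigenvalue functions: those with (one-based) index
`r + 1, …, 2r` tend to zero, those with index `2r + 1, …, 2N` have a nonzero limit. -/
structure IsRefinedIndexing {N : ℕ} (r : ℕ) (ζ : Fin (2 * N) → ℝ → ℂ) : Prop where
  limit_zero : ∀ j : Fin (2 * N), r ≤ (j : ℕ) → (j : ℕ) < 2 * r → Tendsto (ζ j) atTop (𝓝 0)
  limit_ne_zero : ∀ j : Fin (2 * N), 2 * r ≤ (j : ℕ) →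
    ∃ ρ : ℂ, ρ ≠ 0 ∧ Tendsto (ζ j) atTop (𝓝 ρ)

end

end SelectiveOverdamping

/-! Diagonalising the loss block by a real orthogonal matrix and permuting coordinates turns `A(β)`
into `W - iβ diag(δ, 0)`, where `δ` lists the nonzero loss eigenvalues (`exists_blockOp_reduction`).
The spectrum then splits in two (`exists_blockOp_roots`): `rank R` eigenvalues `-iβ u_i` with `u_i →
δ_i`, and `2N - rank R` eigenvalues converging to those of the Hermitian block `W₂₂`.

Overdamping comes from a symmetry. `A(β)` is `i` times a real matrix, so its spectrum is stable
under `z ↦ -conj z`, which acts on the high-loss eigenvalues by `u_i ↦ conj u_i`. The `δ_i` are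
real, nonzero and distinct, so for large `β` the only eigenvalue available as the mirror image of
`-iβ u_i` is itself; hence `u_i` is real (`eventually_re_eq_zero_of_tendsto_norm`).

For any eigenvalue family the low-loss limits are the eigenvalues of `W₂₂`
(`prod_X_sub_C_low_limits_eq`), hence real. `W₂₂` has the form `[[*, F*], [F, 0]]`, with `F` the
restriction of `iΦ` to the kernel of the loss block. If `Ker R ∩ Ker η = 0`, then `F` is injective
and `W₂₂` has rank `2(N - rank R)`, which counts the nonzero limits. -/

namespace SelectiveOverdamping

/-! ### Continuity of the roots of a polynomial -/

/-- Two finite families with the same multiset of values differ by a bijection of the indices. -/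
lemma exists_equiv_of_map_univ_eq {ι κ γ : Type*} [Fintype ι] [Fintype κ] {f : ι → γ} {g : κ → γ}
    (h : Multiset.map f Finset.univ.val = Multiset.map g Finset.univ.val) :
    ∃ e : ι ≃ κ, ∀ i, g (e i) = f i := by
  classical
  have key : ∀ c, Nonempty ({a // f a = c} ≃ {b // g b = c}) := by
    intro c
    rw [← Fintype.card_eq, Fintype.card_subtype, Fintype.card_subtype]
    have := congrArg (Multiset.count c) h
    rw [Multiset.count_map, Multiset.count_map] at this
    simpa [Finset.card_def, Finset.filter_val, eq_comm] using this
  exact ⟨Equiv.ofFiberEquiv fun c => (key c).some, fun i => Equiv.ofFiberEquiv_map _ i⟩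

lemma roots_prod_X_sub_C_univ {ι : Type*} [Fintype ι] (w : ι → ℂ) :
    (∏ i, (X - C (w i))).roots = Multiset.map w Finset.univ.val := by
  rw [Polynomial.roots_prod _ _ (by simp [Finset.prod_ne_zero_iff, X_sub_C_ne_zero])]
  simp

lemma exists_equiv_of_prod_X_sub_C_eq {ι κ : Type*} [Fintype ι] [Fintype κ] {y : ι → ℂ} {w : κ → ℂ}
    (h : ∏ i, (X - C (y i)) = ∏ i, (X - C (w i))) : ∃ e : ι ≃ κ, ∀ i, w (e i) = y i := by
  apply exists_equiv_of_map_univ_eq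
  rw [← roots_prod_X_sub_C_univ, ← roots_prod_X_sub_C_univ, h]

lemma exists_eq_prod_X_sub_C {ι : Type*} [Fintype ι] {p : ℂ[X]} (hm : p.Monic)
    (hd : p.natDegree = Fintype.card ι) : ∃ y : ι → ℂ, p = ∏ i, (X - C (y i)) := by
  have hs := IsAlgClosed.splits p
  have hc : Fintype.card ι = p.roots.toList.length := by
    rw [← hd, Multiset.length_toList]; exact hs.natDegree_eq_card_roots
  let e : ι ≃ Fin p.roots.toList.length := Fintype.equivFinOfCardEq hc
  refine ⟨fun i => p.roots.toList.get (e i), ?_⟩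
  rw [e.prod_comp (fun i => X - C (p.roots.toList.get i))]
  conv_lhs => rw [hs.eq_prod_roots_of_monic hm, ← Multiset.coe_toList p.roots]
  rw [← List.prod_ofFn, Multiset.map_coe, Multiset.prod_coe]
  exact congrArg List.prod (List.ofFn_getElem_eq_map p.roots.toList fun x : ℂ => X - C x).symm

lemma prod_X_sub_C_eq_of_eval_eq {ι κ : Type*} [Fintype ι] [Fintype κ] {y : ι → ℂ} {w : κ → ℂ}
    (h : ∀ x, ∏ i, (x - y i) = ∏ i, (x - w i)) :
    ∏ i, (X - C (y i)) = ∏ i, (X - C (w i)) := by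
  apply Polynomial.funext
  intro x
  simpa [eval_prod] using h x

/-- Pointwise convergence of polynomials of bounded degree implies convergence of their
coefficients. -/
lemma tendsto_coeff_of_tendsto_eval {T : Type*} {l : Filter T} {P : T → ℂ[X]} {p : ℂ[X]} {n : ℕ}
    (hP : ∀ t, (P t).natDegree ≤ n) (hp : p.natDegree ≤ n)
    (h : ∀ x, Tendsto (fun t => (P t).eval x) l (𝓝 (p.eval x))) (k : ℕ) :
    Tendsto (fun t => (P t).coeff k) l (𝓝 (p.coeff k)) := by
  have hinj : Set.InjOn (fun i : ℕ => (i : ℂ)) (Finset.range (n + 1)) :=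
    fun a _ b _ hab => by simpa using hab
  -- Lagrange interpolation at the nodes `0, …, n` makes each coefficient a fixed linear combination
  -- of finitely many values.
  have hrep : ∀ q : ℂ[X], q.natDegree ≤ n → q.coeff k = ∑ i ∈ Finset.range (n + 1),
      q.eval (i : ℂ) * (Lagrange.basis (Finset.range (n + 1)) (fun i : ℕ => (i : ℂ)) i).coeff k := by
    intro q hq
    have hq' : q.degree < (Finset.range (n + 1)).card := by
      rw [Finset.card_range]
      exact lt_of_le_of_lt degree_le_natDegree (by exact_mod_cast Nat.lt_succ_of_le hq)
    conv_lhs => rw [Lagrange.eq_interpolate hinj hq']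
    simp [Lagrange.interpolate_apply]
  simp_rw [hrep _ (hP _)]
  rw [hrep p hp]
  exact tendsto_finsetSum _ fun i _ => (h i).mul_const _

/-- Cauchy's bound for a monic polynomial involves only the lower coefficients, and these are
eventually within 1 of their limits. This supplies the compactness for the convergence of roots. -/
lemma eventually_norm_root_le {T : Type*} {l : Filter T} {P : T → ℂ[X]} {p : ℂ[X]} {n : ℕ}
    (hm : ∀ t, (P t).Monic) (hd : ∀ t, (P t).natDegree = n) (hp : p.natDegree ≤ n)
    (h : ∀ x, Tendsto (fun t => (P t).eval x) l (𝓝 (p.eval x))) :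
    ∃ M : ℝ, ∀ᶠ t in l, ∀ z, (P t).IsRoot z → ‖z‖ ≤ M := by
  have hc : ∀ k, ∀ᶠ t in l, ‖(P t).coeff k‖₊ < ‖p.coeff k‖₊ + 1 := fun k =>
    ((tendsto_coeff_of_tendsto_eval (fun t => (hd t).le) hp h k).nnnorm).eventually_lt_const
      (lt_add_one _)
  refine ⟨(((Finset.range n).sup fun k => ‖p.coeff k‖₊ + 1) + 1 : NNReal), ?_⟩
  filter_upwards [(Finset.range n).eventually_all.2 fun k _ => hc k] with t ht z hz
  have h1 := hz.norm_lt_cauchyBound (hm t).ne_zero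
  rw [cauchyBound, (hm t).leadingCoeff, hd t, nnnorm_one, div_one] at h1
  have h2 : ((Finset.range n).sup fun k => ‖(P t).coeff k‖₊) ≤
      (Finset.range n).sup fun k => ‖p.coeff k‖₊ + 1 :=
    Finset.sup_mono_fun fun k hk => (ht k hk).le
  have h3 := h1.le.trans (add_le_add_left h2 1)
  exact_mod_cast h3

/-- The roots of monic polynomials that converge pointwise can be labelled so that they converge. -/
lemma exists_roots_tendsto {ι T : Type*} [Fintype ι] {l : Filter T} {P : T → ℂ[X]}
    (hm : ∀ t, (P t).Monic) (hd : ∀ t, (P t).natDegree = Fintype.card ι) (w : ι → ℂ)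
    (h : ∀ x, Tendsto (fun t => (P t).eval x) l (𝓝 (∏ i, (x - w i)))) :
    ∃ z : ι → T → ℂ, (∀ t, P t = ∏ i, (X - C (z i t))) ∧ ∀ i, Tendsto (z i) l (𝓝 (w i)) := by
  classical
  choose y hy using fun t => exists_eq_prod_X_sub_C (hm t) (hd t)
  -- For each `t` the roots are ordered so as to lie as close to `w` as possible. Along an
  -- ultrafilter the unordered tuples converge to some `y0`, a rearrangement of `w`; the optimal
  -- ordering does at least as well as that fixed rearrangement.
  choose σ hσ using fun t => Finite.exists_min (fun σ : Equiv.Perm ι => dist (y t ∘ σ) w)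
  refine ⟨fun i t => y t (σ t i), fun t => ?_, ?_⟩
  · conv_lhs => rw [hy t]
    exact (Equiv.prod_comp (σ t) fun i => X - C (y t i)).symm
  suffices H : Tendsto (fun t => y t ∘ σ t) l (𝓝 w) from fun i => (tendsto_pi_nhds.1 H) i
  rw [tendsto_iff_ultrafilter]
  intro g hg
  obtain ⟨M, hM⟩ := eventually_norm_root_le (p := ∏ i, (X - C (w i))) hm hd
    (by simp) (fun x => by simpa [eval_prod] using h x)
  have hM0 : ∀ᶠ t in (g : Filter T), y t ∈ Metric.closedBall (0 : ι → ℂ) (max M 0) := by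
    filter_upwards [hg hM] with t ht
    rw [mem_closedBall_zero_iff, pi_norm_le_iff_of_nonneg (le_max_right _ _)]
    intro i
    refine (ht _ ?_).trans (le_max_left _ _)
    rw [hy t, IsRoot.def, eval_prod]
    exact Finset.prod_eq_zero (Finset.mem_univ i) (by simp)
  obtain ⟨y0, -, hy0⟩ := (isCompact_closedBall (0 : ι → ℂ) (max M 0)).ultrafilter_le_nhds
    (g.map y) (Filter.le_principal_iff.2 hM0)
  have hy0' : Tendsto y g (𝓝 y0) := hy0
  have heq : ∏ i, (X - C (w i)) = ∏ i, (X - C (y0 i)) := by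
    apply prod_X_sub_C_eq_of_eval_eq
    intro x
    refine tendsto_nhds_unique ((h x).mono_left hg) ?_
    have : (fun t => (P t).eval x) = fun t => ∏ i, (x - y t i) := by
      funext t
      conv_lhs => rw [hy t]
      simp [eval_prod]
    rw [this]
    exact tendsto_finsetProd _ fun i _ => tendsto_const_nhds.sub ((tendsto_pi_nhds.1 hy0') i)
  obtain ⟨τ, hτ⟩ := exists_equiv_of_prod_X_sub_C_eq heq
  have h1 : Tendsto (fun t => y t ∘ τ) g (𝓝 w) := by
    rw [tendsto_pi_nhds]
    intro i
    rw [← hτ i]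
    exact (tendsto_pi_nhds.1 hy0') (τ i)
  rw [tendsto_iff_dist_tendsto_zero] at h1 ⊢
  exact squeeze_zero (fun _ => dist_nonneg) (fun t => hσ t τ) h1

/-! ### Large-parameter asymptotics of the characteristic polynomial -/

section Asymptotics

variable {a b : Type*} [Fintype a] [Fintype b] [DecidableEq a] [DecidableEq b]

/-- The operator `W - i β diag(δ, 0)` in coordinates adapted to the loss operator. -/
noncomputable def blockOp (W : Matrix (a ⊕ b) (a ⊕ b) ℂ) (δ : a → ℝ) (β : ℝ) :
    Matrix (a ⊕ b) (a ⊕ b) ℂ :=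
  W - (Complex.I * (β : ℂ)) • Matrix.diagonal (Sum.elim (fun i => (δ i : ℂ)) 0)

lemma tendsto_ofReal_inv_atTop : Tendsto (fun β : ℝ => (β : ℂ)⁻¹) atTop (𝓝 0) := by
  have := (Complex.continuous_ofReal.tendsto 0).comp tendsto_inv_atTop_zero
  simpa [Function.comp_def] using this

/-- Dividing the first block row of `x - blockOp W δ β` by `β` gives a matrix `G` that is continuous
in `s = β⁻¹`. At `s = 0` its upper right block vanishes, so the determinant factors. -/
lemma tendsto_eval_charpoly_blockOp_div_pow (W : Matrix (a ⊕ b) (a ⊕ b) ℂ) (δ : a → ℝ) (x : ℂ) :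
    Tendsto (fun β : ℝ => (blockOp W δ β).charpoly.eval x / (β : ℂ) ^ Fintype.card a) atTop
      (𝓝 ((∏ i, (Complex.I * δ i)) * W.toBlocks₂₂.charpoly.eval x)) := by
  let G : ℂ → Matrix (a ⊕ b) (a ⊕ b) ℂ := fun s => Matrix.fromBlocks
    (s • (Matrix.scalar a x - W.toBlocks₁₁) + Matrix.diagonal fun i => Complex.I * (δ i : ℂ))
    (s • -W.toBlocks₁₂) (-W.toBlocks₂₁) (Matrix.scalar b x - W.toBlocks₂₂)
  have hG : Continuous G := by
    refine Continuous.matrix_fromBlocks ?_ ?_ continuous_const continuous_const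
    · exact (continuous_id.smul continuous_const).add continuous_const
    · exact continuous_id.smul continuous_const
  have h0 : (G 0).det = (∏ i, (Complex.I * δ i)) * W.toBlocks₂₂.charpoly.eval x := by
    simp [G, Matrix.det_fromBlocks_zero₁₂, Matrix.eval_charpoly]
  rw [← h0]
  refine ((hG.matrix_det.tendsto 0).comp tendsto_ofReal_inv_atTop).congr' ?_
  filter_upwards [eventually_ne_atTop (0 : ℝ)] with β hβ
  have hβ' : (β : ℂ) ≠ 0 := by exact_mod_cast hβ
  have hM : G (β : ℂ)⁻¹ = Matrix.diagonal (Sum.elim (fun _ => (β : ℂ)⁻¹) fun _ => 1) *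
      (Matrix.scalar (a ⊕ b) x - blockOp W δ β) := by
    ext i j
    rw [Matrix.diagonal_mul]
    rcases i with i | i <;> rcases j with j | j
    · by_cases hij : i = j
      · subst hij
        simp [G, blockOp, Matrix.toBlocks₁₁]
        field_simp
        ring
      · simp [G, blockOp, Matrix.toBlocks₁₁, hij]
    · simp [G, blockOp, Matrix.toBlocks₁₂]
    · simp [G, blockOp, Matrix.toBlocks₂₁]
    · by_cases hij : i = j
      · subst hij
        simp [G, blockOp, Matrix.toBlocks₂₂]
      · simp [G, blockOp, Matrix.toBlocks₂₂, hij]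
  rw [Function.comp_apply, hM, Matrix.det_mul, Matrix.det_diagonal, Matrix.eval_charpoly]
  simp [div_eq_inv_mul]

/-- Multiplied by `iβ⁻¹`, the operator becomes an `O(β⁻¹)` perturbation of `diag(δ, 0)`; this scale
shows the high-loss eigenvalues. -/
lemma tendsto_eval_charpoly_rescaled (W : Matrix (a ⊕ b) (a ⊕ b) ℂ) (δ : a → ℝ) (x : ℂ) :
    Tendsto (fun β : ℝ => ((Complex.I * (β : ℂ)⁻¹) • W +
      Matrix.diagonal (Sum.elim (fun i => (δ i : ℂ)) 0)).charpoly.eval x) atTop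
      (𝓝 (∏ i : a ⊕ b, (x - Sum.elim (fun i => (δ i : ℂ)) 0 i))) := by
  let G : ℂ → Matrix (a ⊕ b) (a ⊕ b) ℂ := fun s => Matrix.scalar (a ⊕ b) x - ((Complex.I * s) • W +
      Matrix.diagonal (Sum.elim (fun i => (δ i : ℂ)) 0))
  have hG : Continuous G := continuous_const.sub
    (((continuous_const.mul continuous_id).smul continuous_const).add continuous_const)
  have h0 : (G 0).det = ∏ i : a ⊕ b, (x - Sum.elim (fun i => (δ i : ℂ)) 0 i) := by
    simp only [G, mul_zero, zero_smul, zero_add, ← Matrix.eval_charpoly, Matrix.charpoly_diagonal,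
      eval_prod, eval_sub, eval_X, eval_C]
  rw [← h0]
  simp only [Matrix.eval_charpoly]
  exact (hG.matrix_det.tendsto 0).comp tendsto_ofReal_inv_atTop

lemma eval_charpoly_blockOp (W : Matrix (a ⊕ b) (a ⊕ b) ℂ) (δ : a → ℝ) {β : ℝ} (hβ : β ≠ 0)
    (x : ℂ) :
    (blockOp W δ β).charpoly.eval x = (-(Complex.I * β)) ^ Fintype.card (a ⊕ b) *
      ((Complex.I * (β : ℂ)⁻¹) • W +
        Matrix.diagonal (Sum.elim (fun i => (δ i : ℂ)) 0)).charpoly.eval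
        (Complex.I * (β : ℂ)⁻¹ * x) := by
  have hβ' : (β : ℂ) ≠ 0 := by exact_mod_cast hβ
  have hI : -(Complex.I * β) * (Complex.I * (β : ℂ)⁻¹) = 1 := by
    field_simp
    simp
  rw [Matrix.eval_charpoly, Matrix.eval_charpoly, ← Matrix.det_smul]
  congr 1
  rw [smul_sub, smul_add, smul_smul, hI, one_smul, blockOp, neg_smul, neg_smul, ← sub_sub,
    sub_neg_eq_add, ← neg_smul]
  have : -(Complex.I * (β : ℂ)) • (Matrix.scalar (a ⊕ b)) (Complex.I * (β : ℂ)⁻¹ * x) =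
      Matrix.scalar (a ⊕ b) x := by
    ext i j
    by_cases hij : i = j
    · subst hij
      have := congrArg (· * x) hI
      simp only [mul_assoc, one_mul] at this
      simpa [mul_assoc] using this
    · simp [hij]
  rw [this]
  abel

/-- The eigenvalues of `blockOp W δ β` for large `β`: those of order `β`, and those that converge
to the eigenvalues of the lower right block of `W`. -/
lemma exists_blockOp_roots (W : Matrix (a ⊕ b) (a ⊕ b) ℂ) {δ : a → ℝ} (hδ : ∀ i, δ i ≠ 0)
    {w : b → ℂ} (hw : W.toBlocks₂₂.charpoly = ∏ k, (X - C (w k))) :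
    ∃ (u : a → ℝ → ℂ) (v : b → ℝ → ℂ), (∀ i, Tendsto (u i) atTop (𝓝 (δ i : ℂ))) ∧
      (∀ k, Tendsto (v k) atTop (𝓝 (w k))) ∧
      ∀ᶠ β : ℝ in atTop, (blockOp W δ β).charpoly =
        (∏ i, (X - C (-(Complex.I * β) * u i β))) * ∏ k, (X - C (v k β)) := by
  obtain ⟨z, hz, hzlim⟩ := exists_roots_tendsto (ι := a ⊕ b) (l := atTop)
    (P := fun β : ℝ => ((Complex.I * (β : ℂ)⁻¹) • W +
      Matrix.diagonal (Sum.elim (fun i => (δ i : ℂ)) 0)).charpoly)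
    (fun β => Matrix.charpoly_monic _) (fun β => by rw [Matrix.charpoly_natDegree_eq_dim])
    (Sum.elim (fun i => (δ i : ℂ)) 0) (tendsto_eval_charpoly_rescaled W δ)
  have hu : ∀ i, Tendsto (z (Sum.inl i)) atTop (𝓝 (δ i : ℂ)) := fun i => hzlim (Sum.inl i)
  have hfac : ∀ β : ℝ, β ≠ 0 → (blockOp W δ β).charpoly =
      (∏ i, (X - C (-(Complex.I * β) * z (Sum.inl i) β))) *
        ∏ k, (X - C (-(Complex.I * β) * z (Sum.inr k) β)) := by
    intro β hβ
    have hβ' : (β : ℂ) ≠ 0 := by exact_mod_cast hβ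
    apply Polynomial.funext
    intro x
    rw [eval_charpoly_blockOp W δ hβ, hz β, ← Fintype.prod_sum_type
      (fun s => X - C (-(Complex.I * β) * z s β)), eval_prod, eval_prod, ← Finset.card_univ,
      ← Finset.prod_const, ← Finset.prod_mul_distrib]
    refine Finset.prod_congr rfl fun s _ => ?_
    simp only [eval_sub, eval_X, eval_C]
    field_simp
    linear_combination (-x) * Complex.I_sq
  -- The remaining rescaled roots tend to 0, which says nothing about them after multiplication by
  -- `β`. Their product polynomial does converge: it is the full characteristic polynomial over the
  -- high-loss factors, both normalised by the same power of `β`.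
  let L : ℝ → ℂ[X] := fun β => ∏ k, (X - C (-(Complex.I * β) * z (Sum.inr k) β))
  have hLlim : ∀ x, Tendsto (fun β => (L β).eval x) atTop (𝓝 (∏ k, (x - w k))) := by
    intro x
    have hc : (∏ i, (Complex.I * δ i) : ℂ) ≠ 0 :=
      Finset.prod_ne_zero_iff.2 fun i _ => mul_ne_zero Complex.I_ne_zero (by exact_mod_cast hδ i)
    have h1 := tendsto_eval_charpoly_blockOp_div_pow W δ x
    have h2 : Tendsto (fun β : ℝ => ∏ i, (x * (β : ℂ)⁻¹ + Complex.I * z (Sum.inl i) β)) atTop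
        (𝓝 (∏ i, (Complex.I * δ i))) := by
      refine tendsto_finsetProd _ fun i _ => ?_
      simpa using (tendsto_ofReal_inv_atTop.const_mul x).add ((hu i).const_mul Complex.I)
    have h3 := h1.div h2 hc
    rw [mul_div_cancel_left₀ _ hc, hw, eval_prod] at h3
    simp only [eval_sub, eval_X, eval_C] at h3
    refine h3.congr' ?_
    filter_upwards [eventually_ne_atTop (0 : ℝ), h2.eventually_ne hc] with β hβ hne
    have hβ' : (β : ℂ) ≠ 0 := by exact_mod_cast hβ
    rw [Pi.div_apply, div_eq_iff hne, hfac β hβ, eval_mul, mul_comm, mul_div_assoc]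
    congr 1
    rw [eval_prod, ← Finset.card_univ, ← Finset.prod_const, ← Finset.prod_div_distrib]
    refine Finset.prod_congr rfl fun i _ => ?_
    simp only [eval_sub, eval_X, eval_C]
    field_simp
    ring
  obtain ⟨v, hv, hvlim⟩ := exists_roots_tendsto (P := L)
    (fun β => monic_prod_of_monic _ _ fun k _ => monic_X_sub_C _)
    (fun β => by
      rw [natDegree_prod_of_monic _ _ fun k _ => monic_X_sub_C _]
      simp only [natDegree_X_sub_C, Finset.sum_const, Finset.card_univ, smul_eq_mul, mul_one])
    w hLlim
  refine ⟨fun i => z (Sum.inl i), v, hu, hvlim, ?_⟩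
  filter_upwards [eventually_ne_atTop (0 : ℝ)] with β hβ
  rw [hfac β hβ, ← hv β]

/-- If the spectrum is symmetric about the imaginary axis and the `δ i` are distinct, then every
eigenvalue that tends to infinity is eventually purely imaginary. -/
lemma eventually_re_eq_zero_of_tendsto_norm (W : Matrix (a ⊕ b) (a ⊕ b) ℂ) {δ : a → ℝ}
    (hδ : ∀ i, δ i ≠ 0) (hinj : Function.Injective δ)
    (hsym : ∀ β z, (blockOp W δ β).charpoly.IsRoot z →
      (blockOp W δ β).charpoly.IsRoot (-(starRingEnd ℂ) z))
    {z : ℝ → ℂ} (hz : Tendsto (fun β => ‖z β‖) atTop atTop)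
    (hroot : ∀ᶠ β in atTop, (blockOp W δ β).charpoly.IsRoot (z β)) :
    ∀ᶠ β in atTop, (z β).re = 0 := by
  obtain ⟨w, hw⟩ := exists_eq_prod_X_sub_C (ι := b) (Matrix.charpoly_monic W.toBlocks₂₂)
    (Matrix.charpoly_natDegree_eq_dim _)
  obtain ⟨u, v, hu, hv, hfac⟩ := exists_blockOp_roots W hδ hw
  have hconj : ∀ i, Tendsto (fun β => (starRingEnd ℂ) (u i β)) atTop (𝓝 (δ i : ℂ)) := by
    intro i
    simpa [Function.comp_def] using (Complex.continuous_conj.tendsto _).comp (hu i)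
  have h1 : ∀ᶠ β in atTop, ∀ i j, i ≠ j → (starRingEnd ℂ) (u i β) ≠ u j β := by
    simp only [eventually_all]
    intro i j hij
    exact (((hconj i).sub (hu j)).eventually_ne (sub_ne_zero.2 (by exact_mod_cast hinj.ne hij))).mono
      fun _ => sub_ne_zero.1
  -- This excludes a low-loss mirror image: equality would mean `-iβ conj u_i = v_k`, but the
  -- right-hand side here tends to 0 and `conj u_i` to `δ i ≠ 0`.
  have h2 : ∀ᶠ β : ℝ in atTop, ∀ i k, (starRingEnd ℂ) (u i β) ≠ Complex.I * ((β : ℂ)⁻¹ * v k β) := by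
    simp only [eventually_all]
    intro i k
    have := (hconj i).sub ((tendsto_ofReal_inv_atTop.mul (hv k)).const_mul Complex.I)
    exact (this.eventually_ne (by simpa using hδ i)).mono fun _ => sub_ne_zero.1
  have h3 : ∀ᶠ β in atTop, ∀ k, z β ≠ v k β := by
    rw [eventually_all]
    intro k
    have hb := (hv k).norm.eventually_lt_const (lt_add_one _)
    filter_upwards [hb, hz.eventually_gt_atTop (‖w k‖ + 1)] with β hβ1 hβ2 heq
    rw [heq] at hβ2
    exact lt_asymm hβ1 hβ2
  filter_upwards [h1, h2, h3, hfac, hroot, eventually_ne_atTop (0 : ℝ)]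
    with β h1 h2 h3 hfac hroot hβ
  have hβ' : (β : ℂ) ≠ 0 := by exact_mod_cast hβ
  have hcase : ∀ x, (blockOp W δ β).charpoly.IsRoot x →
      (∃ i, x = -(Complex.I * β) * u i β) ∨ ∃ k, x = v k β := by
    intro x hx
    rw [hfac, IsRoot.def, eval_mul, mul_eq_zero, eval_prod, eval_prod] at hx
    simpa [Finset.prod_eq_zero_iff, sub_eq_zero, add_eq_zero_iff_eq_neg] using hx
  rcases hcase _ hroot with ⟨i, hi⟩ | ⟨k, hk⟩
  swap
  · exact absurd hk (h3 k)
  have hs := hcase _ (hsym β _ hroot)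
  rw [hi] at hs
  simp only [map_mul, map_neg, Complex.conj_I, Complex.conj_ofReal] at hs
  rcases hs with ⟨j, hj⟩ | ⟨k, hk⟩
  · have hj' : (starRingEnd ℂ) (u i β) = u j β := by
      have hne : -(Complex.I * (β : ℂ)) ≠ 0 := neg_ne_zero.2 (mul_ne_zero Complex.I_ne_zero hβ')
      apply mul_left_cancel₀ hne
      rw [← hj]
      ring
    by_cases hij : i = j
    · subst hij
      rw [hi]
      have : (u i β).im = 0 := Complex.conj_eq_iff_im.1 hj'
      simp [this]
    · exact absurd hj' (h1 i j hij)
  · refine absurd ?_ (h2 i k)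
    rw [← hk]
    field_simp
    linear_combination ((starRingEnd ℂ) (u i β)) * Complex.I_sq

/-- High-loss factors drop out of quotients of characteristic polynomial values, whatever their rate
of growth. -/
lemma tendsto_sub_div_sub_of_tendsto_norm {z : ℝ → ℂ} (hz : Tendsto (fun β => ‖z β‖) atTop atTop)
    (x y : ℂ) : Tendsto (fun β => (x - z β) / (y - z β)) atTop (𝓝 1) := by
  have h1 : Tendsto (fun β => ‖y - z β‖) atTop atTop := by
    refine tendsto_atTop_mono (fun β => ?_) (tendsto_atTop_add_const_right _ (-‖y‖) hz)
    have := norm_sub_norm_le (z β) y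
    rw [norm_sub_rev] at this
    linarith
  have h2 : Tendsto (fun β => (y - z β)⁻¹) atTop (𝓝 0) :=
    tendsto_inv₀_cobounded.comp (tendsto_norm_atTop_iff_cobounded.1 h1)
  have h3 := (h2.const_mul (x - y)).const_add 1
  rw [mul_zero, add_zero] at h3
  refine h3.congr' ?_
  filter_upwards [h1.eventually_gt_atTop 0] with β hβ
  have : y - z β ≠ 0 := norm_pos_iff.1 hβ
  field_simp
  ring

/-- The limits of the bounded eigenvalues are the eigenvalues of the lower right block of `W`. -/
lemma prod_X_sub_C_low_limits_eq (W : Matrix (a ⊕ b) (a ⊕ b) ℂ) {δ : a → ℝ} (hδ : ∀ i, δ i ≠ 0)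
    {ι κ : Type*} [Fintype ι] [Fintype κ] {f : ι → ℝ → ℂ} {g : κ → ℝ → ℂ} {ρ : κ → ℂ}
    (hfac : ∀ᶠ β in atTop, (blockOp W δ β).charpoly =
      (∏ i, (X - C (f i β))) * ∏ k, (X - C (g k β)))
    (hf : ∀ i, Tendsto (fun β => ‖f i β‖) atTop atTop)
    (hg : ∀ k, Tendsto (g k) atTop (𝓝 (ρ k))) :
    ∏ k, (X - C (ρ k)) = W.toBlocks₂₂.charpoly := by
  set p : ℂ[X] := ∏ k, (X - C (ρ k)) with hp
  set q : ℂ[X] := W.toBlocks₂₂.charpoly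
  have hpm : p.Monic := monic_prod_of_monic _ _ fun k _ => monic_X_sub_C _
  have hqm : q.Monic := Matrix.charpoly_monic _
  obtain ⟨x₀, hx₀⟩ : ∃ x₀, (p * q).eval x₀ ≠ 0 := by
    by_contra! h
    exact (hpm.mul hqm).ne_zero (Polynomial.funext fun x => by simpa using h x)
  rw [eval_mul] at hx₀
  have hp0 := left_ne_zero_of_mul hx₀
  have hq0 := right_ne_zero_of_mul hx₀
  have hc : (∏ i, (Complex.I * δ i) : ℂ) ≠ 0 :=
    Finset.prod_ne_zero_iff.2 fun i _ => mul_ne_zero Complex.I_ne_zero (by exact_mod_cast hδ i)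
  -- The quotient of the values at `x` and `x₀` has two limits: one from the block asymptotics,
  -- where the power of `β` cancels, and one from the given factorisation. Thus `p` and `q` are
  -- proportional, and being monic they agree.
  have key : ∀ x, p.eval x * q.eval x₀ = q.eval x * p.eval x₀ := by
    intro x
    have h1 : Tendsto (fun β => (blockOp W δ β).charpoly.eval x / (blockOp W δ β).charpoly.eval x₀)
        atTop (𝓝 (q.eval x / q.eval x₀)) := by
      have := (tendsto_eval_charpoly_blockOp_div_pow W δ x).div
        (tendsto_eval_charpoly_blockOp_div_pow W δ x₀) (mul_ne_zero hc hq0)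
      rw [mul_div_mul_left _ _ hc] at this
      refine this.congr' ?_
      filter_upwards [eventually_ne_atTop (0 : ℝ)] with β hβ
      exact div_div_div_cancel_right₀ (pow_ne_zero _ (by exact_mod_cast hβ)) _ _
    have h2 : Tendsto (fun β => (blockOp W δ β).charpoly.eval x / (blockOp W δ β).charpoly.eval x₀)
        atTop (𝓝 (p.eval x / p.eval x₀)) := by
      have ha : Tendsto (fun β => ∏ i, ((x - f i β) / (x₀ - f i β))) atTop (𝓝 (∏ _i : ι, 1)) :=
        tendsto_finsetProd _ fun i _ => tendsto_sub_div_sub_of_tendsto_norm (hf i) x x₀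
      have hb : ∀ y, Tendsto (fun β => ∏ k, (y - g k β)) atTop (𝓝 (p.eval y)) := by
        intro y
        rw [hp, eval_prod]
        simp only [eval_sub, eval_X, eval_C]
        exact tendsto_finsetProd _ fun k _ => (hg k).const_sub y
      have := ha.mul ((hb x).div (hb x₀) hp0)
      rw [Finset.prod_const_one, one_mul] at this
      refine this.congr' ?_
      filter_upwards [hfac] with β hβ
      rw [hβ]
      simp [eval_prod, Finset.prod_div_distrib, mul_div_mul_comm]
    have h3 := tendsto_nhds_unique h1 h2
    rw [div_eq_div_iff hq0 hp0] at h3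
    exact h3.symm
  have hC : C (q.eval x₀) * p = C (p.eval x₀) * q := by
    apply Polynomial.funext
    intro x
    simp only [eval_mul, eval_C]
    linear_combination key x
  have hlead := congrArg leadingCoeff hC
  rw [leadingCoeff_mul, leadingCoeff_mul, hpm.leadingCoeff, hqm.leadingCoeff, leadingCoeff_C,
    leadingCoeff_C, mul_one, mul_one] at hlead
  rw [hlead] at hC
  exact mul_left_cancel₀ (C_ne_zero.2 hp0) hC

end Asymptotics

/-! ### Coordinates adapted to the loss operator -/

lemma toC_mul {l m n : Type*} [Fintype m] (A : Matrix l m ℝ) (B : Matrix m n ℝ) :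
    toC (A * B) = toC A * toC B :=
  Matrix.map_mul (f := Complex.ofRealHom)

lemma toC_one {n : Type*} [DecidableEq n] : toC (1 : Matrix n n ℝ) = 1 :=
  Matrix.map_one _ Complex.ofReal_zero Complex.ofReal_one

lemma toC_diagonal {n : Type*} [DecidableEq n] (d : n → ℝ) :
    toC (Matrix.diagonal d) = Matrix.diagonal fun i => (d i : ℂ) :=
  Matrix.diagonal_map Complex.ofReal_zero

lemma conjTranspose_toC {m n : Type*} (A : Matrix m n ℝ) :
    (toC A).conjTranspose = toC A.transpose := by
  ext i j
  simp [toC]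

lemma toC_mulVec_eq_zero {m n : Type*} [Fintype n] {A : Matrix m n ℝ} {x : n → ℂ}
    (h : (toC A).mulVec x = 0) :
    A.mulVec (fun i => (x i).re) = 0 ∧ A.mulVec (fun i => (x i).im) = 0 := by
  constructor <;> funext i
  · have := congrArg Complex.re (congrFun h i)
    simpa [toC, Matrix.mulVec, dotProduct] using this
  · have := congrArg Complex.im (congrFun h i)
    simpa [toC, Matrix.mulVec, dotProduct] using this

open scoped ComplexOrder in
/-- The rank of a Hermitian block matrix with a vanishing diagonal block and an injective
off-diagonal block. -/
lemma rank_fromBlocks_conjTranspose_zero {m n : Type*} [Fintype m] [Fintype n]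
    (A : Matrix m m ℂ) (F : Matrix n m ℂ) (hF : ∀ x, F.mulVec x = 0 → x = 0) :
    (Matrix.fromBlocks A F.conjTranspose F 0).rank = 2 * Fintype.card m := by
  classical
  have hrank : F.conjTranspose.rank = Fintype.card m := by
    rw [Matrix.rank_conjTranspose, Matrix.rank, LinearMap.finrank_range_of_inj
      ((injective_iff_map_eq_zero F.mulVecLin).2 hF), Module.finrank_fintype_fun_eq_card]
  let incl : (n → ℂ) →ₗ[ℂ] (m ⊕ n → ℂ) :=
    { toFun := fun y => Sum.elim 0 y
      map_add' := fun x y => by ext i; cases i <;> simp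
      map_smul' := fun c y => by ext i; cases i <;> simp }
  have hincl : Function.Injective incl := fun x y h => funext fun i => congrFun h (Sum.inr i)
  -- The second block row forces the first component into `ker F = 0`, so the kernel is `0 ⊕ ker
  -- F*`, whatever `A` is.
  have hker : LinearMap.ker (Matrix.fromBlocks A F.conjTranspose F 0).mulVecLin =
      (LinearMap.ker F.conjTranspose.mulVecLin).map incl := by
    ext z
    simp only [LinearMap.mem_ker, Submodule.mem_map, Matrix.mulVecLin_apply]
    constructor
    · intro h
      rw [Matrix.fromBlocks_mulVec] at h
      have h2 : F.mulVec (z ∘ Sum.inl) = 0 := by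
        funext i
        simpa using congrFun h (Sum.inr i)
      have h3 := hF _ h2
      refine ⟨z ∘ Sum.inr, ?_, ?_⟩
      · funext i
        simpa [h3] using congrFun h (Sum.inl i)
      · funext i
        rcases i with i | i
        · exact (congrFun h3 i).symm
        · rfl
    · rintro ⟨y, hy, rfl⟩
      rw [Matrix.fromBlocks_mulVec]
      funext i
      rcases i with i | i
      · simpa [incl, Function.comp_def, ← Pi.zero_def] using congrFun hy i
      · simp [incl, Function.comp_def, ← Pi.zero_def]
  have h1 := LinearMap.finrank_range_add_finrank_ker
    (Matrix.fromBlocks A F.conjTranspose F 0).mulVecLin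
  have h2 := LinearMap.finrank_range_add_finrank_ker F.conjTranspose.mulVecLin
  rw [hker, ← (Submodule.equivMapOfInjective incl hincl _).finrank_eq] at h1
  simp only [Module.finrank_fintype_fun_eq_card, Fintype.card_sum] at h1 h2
  rw [Matrix.rank] at hrank ⊢
  omega

section Reduction

variable {N : ℕ} {α η θ R : Matrix (Fin N) (Fin N) ℝ}

lemma isUnit_Kp (hα : α.PosDef) : IsUnit (Kp α) := by
  have h : CFC.sqrt α * CFC.sqrt α = α := CFC.sqrt_mul_sqrt_self α hα.posSemidef.nonneg
  have h1 : IsUnit (CFC.sqrt α) := by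
    rw [Matrix.isUnit_iff_isUnit_det]
    have h2 := congrArg Matrix.det h
    rw [Matrix.det_mul] at h2
    rw [isUnit_iff_ne_zero]
    intro h0
    rw [h0, zero_mul] at h2
    exact hα.det_pos.ne h2
  exact (Matrix.isUnit_nonsing_inv_iff).2 h1

lemma isHermitian_lossBlock (hR : R.IsHermitian) :
    (Kp α * R * (Kp α).transpose).IsHermitian := by
  have := Matrix.isHermitian_mul_mul_conjTranspose (Kp α) hR
  simpa [Matrix.conjTranspose_eq_transpose_of_trivial] using this

lemma rank_lossBlock (hα : α.PosDef) : (Kp α * R * (Kp α).transpose).rank = R.rank := by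
  have h := (Matrix.isUnit_iff_isUnit_det _).1 (isUnit_Kp hα)
  rw [Matrix.rank_mul_eq_left_of_isUnit_det _ _ (by rwa [Matrix.det_transpose]),
    Matrix.rank_mul_eq_right_of_isUnit_det _ _ h]

lemma isHermitian_Omega (hθ : θ.transpose = -θ) : (Omega α η θ).IsHermitian := by
  have h1 : (Kp α * θ * (Kp α).transpose).transpose = -(Kp α * θ * (Kp α).transpose) := by
    rw [Matrix.transpose_mul, Matrix.transpose_mul, hθ, Matrix.transpose_transpose]
    simp [Matrix.mul_assoc]
  have h2 : toC (-(Kp α * θ * (Kp α).transpose)) = -toC (Kp α * θ * (Kp α).transpose) := by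
    ext i j
    simp [toC]
  rw [Matrix.IsHermitian, Omega, Matrix.fromBlocks_conjTranspose]
  simp only [Matrix.conjTranspose_smul, conjTranspose_toC, Matrix.conjTranspose_zero,
    Matrix.transpose_transpose, h1, h2]
  simp

/-- The spectrum of `A(β)` is symmetric about the imaginary axis. -/
lemma isRoot_charpoly_systemOp_neg_conj (β : ℝ) {z : ℂ}
    (hz : (systemOp α η θ R β).charpoly.IsRoot z) :
    (systemOp α η θ R β).charpoly.IsRoot (-(starRingEnd ℂ) z) := by
  set A := systemOp α η θ R β with hA
  -- Every entry of `A(β)` is purely imaginary.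
  have hconj : A.map (starRingEnd ℂ) = -A := by
    ext i j
    rcases i with i | i <;> rcases j with j | j <;>
      simp [hA, systemOp, Omega, lossB, toC, Complex.conj_ofNat]
    ring
  rw [IsRoot.def, Matrix.eval_charpoly] at hz ⊢
  have h1 : Matrix.scalar (Fin N ⊕ Fin N) (-(starRingEnd ℂ) z) - A =
      -((starRingEnd ℂ).mapMatrix (Matrix.scalar (Fin N ⊕ Fin N) z - A)) := by
    rw [map_sub, RingHom.mapMatrix_apply, RingHom.mapMatrix_apply, hconj]
    ext i j
    by_cases hij : i = j
    · subst hij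
      simp
      ring
    · simp [hij]
  rw [h1, Matrix.det_neg, ← RingHom.map_det, hz]
  simp

lemma Kq_mul_Kq (hη : η.PosSemidef) : Kq η * Kq η = η := CFC.sqrt_mul_sqrt_self η hη.nonneg

/-- The vectors annihilated both by the loss block and by `Φ` vanish. -/
lemma eq_zero_of_lossBlock_mulVec_eq_zero (hα : α.PosDef) (hη : η.PosSemidef)
    (hker : LinearMap.ker R.mulVecLin ⊓ LinearMap.ker η.mulVecLin = ⊥) {y : Fin N → ℝ}
    (h1 : (Kp α * R * (Kp α).transpose).mulVec y = 0) (h2 : (Phi α η).mulVec y = 0) : y = 0 := by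
  have hK := isUnit_Kp hα
  have hKt : IsUnit (Kp α).transpose := (Matrix.isUnit_transpose _).2 hK
  have h3 : R.mulVec ((Kp α).transpose.mulVec y) = 0 := by
    rw [Matrix.mul_assoc, ← Matrix.mulVec_mulVec, ← Matrix.mulVec_mulVec] at h1
    exact Matrix.mulVec_injective_of_isUnit hK (by rw [h1, Matrix.mulVec_zero])
  have h4 : η.mulVec ((Kp α).transpose.mulVec y) = 0 := by
    rw [Phi, ← Matrix.mulVec_mulVec] at h2
    conv_lhs => rw [← Kq_mul_Kq hη]
    rw [← Matrix.mulVec_mulVec, h2, Matrix.mulVec_zero]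
  have h5 : (Kp α).transpose.mulVec y ∈
      LinearMap.ker R.mulVecLin ⊓ LinearMap.ker η.mulVecLin :=
    ⟨h3, h4⟩
  rw [hker, Submodule.mem_bot] at h5
  exact Matrix.mulVec_injective_of_isUnit hKt (by rw [h5, Matrix.mulVec_zero])

/-- Under the generic condition the nonzero eigenvalues of the loss block are distinct. -/
lemma eigenvalues_injOn_of_genericCondition (hgen : GenericCondition α R)
    {U : Matrix (Fin N) (Fin N) ℝ} {d : Fin N → ℝ} (hU : U.transpose * U = 1)
    (hd : Kp α * R * (Kp α).transpose * U = U * Matrix.diagonal d)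
    {i j : Fin N} (hi : d i ≠ 0) (hij : d i = d j) : i = j := by
  by_contra hne
  let x : Fin N → Fin N ⊕ Fin N → ℂ := fun k => Sum.elim (fun l => (U l k : ℂ)) 0
  have hx : ∀ k, (lossB α R).mulVecLin (x k) = (d k : ℂ) • x k := by
    intro k
    rw [Matrix.mulVecLin_apply, lossB, Matrix.fromBlocks_mulVec]
    funext l
    rcases l with l | l
    · have := congrFun (congrFun hd l) k
      rw [Matrix.mul_diagonal, Matrix.mul_apply] at this
      have h2 := congrArg (fun t : ℝ => (t : ℂ)) this
      simpa [x, Matrix.mulVec, dotProduct, toC, mul_comm] using h2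
    · simp [x]
  have hli : LinearIndependent ℂ x := by
    rw [Fintype.linearIndependent_iff]
    intro g hg
    have hg' : (toC U).mulVec g = 0 := by
      funext l
      have := congrFun hg (Sum.inl l)
      simpa [x, Matrix.mulVec, dotProduct, toC, mul_comm, Finset.sum_apply] using this
    have h1 : g = 0 := by
      have := congrArg (toC U.transpose).mulVec hg'
      rwa [Matrix.mulVec_mulVec, ← toC_mul, hU, toC_one, Matrix.one_mulVec, Matrix.mulVec_zero]
        at this
    exact fun k => congrFun h1 k
  have hmem : ∀ k, d k ≠ 0 → x k ∈ lossSubspace α R := by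
    intro k hk
    refine ⟨(d k : ℂ)⁻¹ • x k, ?_⟩
    rw [map_smul, hx, smul_smul, inv_mul_cancel₀ (by exact_mod_cast hk), one_smul]
  have hj : d j ≠ 0 := hij ▸ hi
  have hEmem : ∀ k (hk : d k ≠ 0), d k = d i →
      (⟨x k, hmem k hk⟩ : lossSubspace α R) ∈
        Module.End.eigenspace (lossB2 α R) (d i : ℂ) := by
    intro k hk hki
    rw [Module.End.mem_eigenspace_iff]
    apply Subtype.ext
    have := hx k
    rw [hki] at this
    exact this
  -- Two independent eigenvectors for one eigenvalue give geometric, hence algebraic, multiplicity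
  -- at least 2, against the simplicity of the roots.
  let y : Fin 2 → Module.End.eigenspace (lossB2 α R) (d i : ℂ) :=
    ![⟨⟨x i, hmem i hi⟩, hEmem i hi rfl⟩, ⟨⟨x j, hmem j hj⟩, hEmem j hj hij.symm⟩]
  have hy : LinearIndependent ℂ y := by
    apply LinearIndependent.of_comp
      ((lossSubspace α R).subtype ∘ₗ (Module.End.eigenspace (lossB2 α R) (d i : ℂ)).subtype)
    have hinj : Function.Injective ![i, j] := by
      intro p q
      fin_cases p <;> fin_cases q <;> simp [hne, Ne.symm hne]
    convert hli.comp _ hinj using 1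
    funext p
    fin_cases p <;> rfl
  have hcard := hy.fintype_card_le_finrank
  have hle := (LinearMap.finrank_eigenspace_le (lossB2 α R) (d i : ℂ))
  have hcount := Multiset.nodup_iff_count_le_one.1 hgen (d i : ℂ)
  rw [count_roots] at hcount
  rw [Fintype.card_fin] at hcard
  omega

/-- In suitable coordinates `A(β)` has the form `W - i β diag(δ, 0)`. -/
lemma exists_blockOp_reduction (hα : α.PosDef) (hη : η.PosSemidef) (hθ : θ.transpose = -θ)
    (hR : R.PosSemidef) (hgen : GenericCondition α R) :
    ∃ (δ : Fin R.rank → ℝ)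
      (W : Matrix (Fin R.rank ⊕ Fin (2 * N - R.rank)) (Fin R.rank ⊕ Fin (2 * N - R.rank)) ℂ),
      Function.Injective δ ∧ (∀ i, δ i ≠ 0) ∧ W.toBlocks₂₂.IsHermitian ∧
      (∀ β, (systemOp α η θ R β).charpoly = (blockOp W δ β).charpoly) ∧
      (LinearMap.ker R.mulVecLin ⊓ LinearMap.ker η.mulVecLin = ⊥ →
        W.toBlocks₂₂.rank = 2 * (N - R.rank)) := by
  have hB := isHermitian_lossBlock (α := α) hR.isHermitian
  set d := hB.eigenvalues
  set U : Matrix (Fin N) (Fin N) ℝ := (hB.eigenvectorUnitary : Matrix (Fin N) (Fin N) ℝ)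
  have hU : U.transpose * U = 1 := by
    have := Unitary.coe_star_mul_self hB.eigenvectorUnitary
    rwa [Matrix.star_eq_conjTranspose, Matrix.conjTranspose_eq_transpose_of_trivial] at this
  have hU' : U * U.transpose = 1 := mul_eq_one_comm.1 hU
  have hspec : Kp α * R * (Kp α).transpose = U * Matrix.diagonal d * U.transpose := by
    have := hB.spectral_theorem
    rw [Unitary.conjStarAlgAut_apply, Matrix.star_eq_conjTranspose,
      Matrix.conjTranspose_eq_transpose_of_trivial] at this
    exact this
  have hdU : Kp α * R * (Kp α).transpose * U = U * Matrix.diagonal d := by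
    rw [hspec, Matrix.mul_assoc, hU, Matrix.mul_one]
  have hcard : Fintype.card {i // d i ≠ 0} = R.rank := by
    rw [← rank_lossBlock hα, hB.rank_eq_card_non_zero_eigs]
  have hcard' : Fintype.card {i // ¬ d i ≠ 0} = N - R.rank := by
    rw [Fintype.card_subtype_compl, hcard, Fintype.card_fin]
  have hrN : R.rank ≤ N := by simpa using R.rank_le_card_width
  let ea : Fin R.rank ≃ {i // d i ≠ 0} := (Fintype.equivFinOfCardEq hcard).symm
  let eb : Fin (2 * N - R.rank) ≃ {i // ¬ d i ≠ 0} ⊕ Fin N :=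
    (Fintype.equivFinOfCardEq (by
      rw [Fintype.card_sum, hcard', Fintype.card_fin]; omega)).symm
  -- The nonzero loss eigenvalues come first; the second summand collects the kernel of the loss
  -- block and the whole second copy of `Fin N`.
  let e : Fin R.rank ⊕ Fin (2 * N - R.rank) ≃ Fin N ⊕ Fin N :=
    (ea.sumCongr eb).trans ((Equiv.sumAssoc _ _ _).symm.trans
      ((Equiv.sumCompl fun i => d i ≠ 0).sumCongr (Equiv.refl (Fin N))))
  let V : Matrix (Fin N ⊕ Fin N) (Fin N ⊕ Fin N) ℂ := Matrix.fromBlocks (toC U) 0 0 1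
  have hVV : V * V.conjTranspose = 1 := by
    simp [V, Matrix.fromBlocks_conjTranspose, Matrix.fromBlocks_multiply, conjTranspose_toC,
      ← toC_mul, hU', toC_one]
  let W₀ := V.conjTranspose * Omega α η θ * V
  have hW₀ : W₀.IsHermitian := by
    simpa using Matrix.isHermitian_conjTranspose_mul_mul V (isHermitian_Omega hθ)
  have hW₀B : V.conjTranspose * lossB α R * V =
      Matrix.diagonal (Sum.elim (fun i => (d i : ℂ)) 0) := by
    simp only [V, lossB, Matrix.fromBlocks_conjTranspose, Matrix.fromBlocks_multiply,
      conjTranspose_toC, ← toC_mul, Matrix.mul_zero, Matrix.zero_mul, add_zero,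
      Matrix.conjTranspose_zero]
    rw [Matrix.mul_assoc U.transpose, hdU, ← Matrix.mul_assoc, hU, Matrix.one_mul, toC_diagonal,
      ← Matrix.fromBlocks_diagonal]
    simp
  have hW₀Omega : W₀ = Matrix.fromBlocks
      ((-(2 * Complex.I)) • toC (U.transpose * (Kp α * θ * (Kp α).transpose) * U))
      (Complex.I • toC (Phi α η * U)).conjTranspose (Complex.I • toC (Phi α η * U)) 0 := by
    simp only [W₀, V, Omega, Matrix.fromBlocks_conjTranspose, Matrix.fromBlocks_multiply,
      conjTranspose_toC, toC_mul, Matrix.mul_zero, Matrix.zero_mul, add_zero,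
      Matrix.conjTranspose_zero, Matrix.conjTranspose_smul, Matrix.conjTranspose_mul,
      Matrix.conjTranspose_one, Matrix.one_mul, Matrix.mul_one, Matrix.mul_smul, zero_add]
    simp
  refine ⟨fun i => d (ea i), W₀.submatrix e e, ?_, fun i => (ea i).2, ?_, ?_, ?_⟩
  · intro i j hij
    exact ea.injective (Subtype.ext
      (eigenvalues_injOn_of_genericCondition hgen hU hdU (ea i).2 hij))
  · exact hW₀.submatrix (e ∘ Sum.inr)
  · intro β
    have h1 : (systemOp α η θ R β).charpoly =
        (V.conjTranspose * systemOp α η θ R β * V).charpoly := by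
      rw [Matrix.charpoly_mul_comm, ← Matrix.mul_assoc, hVV, Matrix.one_mul]
    rw [h1, ← Matrix.charpoly_reindex e.symm]
    congr 1
    rw [systemOp, Matrix.mul_sub, Matrix.sub_mul, Matrix.mul_smul, Matrix.smul_mul, hW₀B, blockOp,
      Matrix.reindex_apply, Equiv.symm_symm, Matrix.submatrix_sub, Matrix.submatrix_smul]
    simp only [Pi.sub_apply, Pi.smul_apply, Matrix.submatrix_diagonal_equiv]
    congr 3
    funext i
    rcases i with i | k
    · rfl
    · rcases hk : eb k with k' | k'
      · have := not_not.1 k'.2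
        simp [e, hk, this]
      · simp [e, hk]
  · intro hker
    let F : Matrix (Fin N) {i // ¬ d i ≠ 0} ℝ := (Phi α η * U).submatrix id Subtype.val
    have hblock : (W₀.submatrix e e).toBlocks₂₂ = (Matrix.fromBlocks
        ((-(2 * Complex.I)) • toC ((U.transpose * (Kp α * θ * (Kp α).transpose) * U).submatrix
          (Subtype.val : {i // ¬ d i ≠ 0} → Fin N) Subtype.val))
        (Complex.I • toC F).conjTranspose (Complex.I • toC F) 0).submatrix eb eb := by
      rw [hW₀Omega]
      ext k l
      rcases hk : eb k with k' | k' <;> rcases hl : eb l with l' | l' <;>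
        simp [Matrix.toBlocks₂₂, e, hk, hl, F, toC]
    rw [hblock, Matrix.rank_submatrix, rank_fromBlocks_conjTranspose_zero, hcard']
    have hFreal : ∀ x, F.mulVec x = 0 → x = 0 := by
      intro x hx
      -- `E` includes the coordinates with `d = 0`, so `U E x` lies in the kernel of the loss block,
      -- and `F x = 0` says that `Φ` kills it too.
      let E : Matrix (Fin N) {i // ¬ d i ≠ 0} ℝ :=
        (1 : Matrix (Fin N) (Fin N) ℝ).submatrix id Subtype.val
      have hFE : F = Phi α η * U * E := by
        ext i k
        simp [F, E, Matrix.mul_apply, Matrix.one_apply]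
      have hdE : Matrix.diagonal d * E = 0 := by
        ext i k
        by_cases hik : i = k
        · have := not_not.1 k.2
          simp [E, Matrix.diagonal_mul, hik, this]
        · simp [E, Matrix.diagonal_mul, hik]
      have hy : U.mulVec (E.mulVec x) = 0 := by
        apply eq_zero_of_lossBlock_mulVec_eq_zero hα hη hker
        · rw [Matrix.mulVec_mulVec, Matrix.mulVec_mulVec, hdU,
            Matrix.mul_assoc, hdE, Matrix.mul_zero, Matrix.zero_mulVec]
        · rw [Matrix.mulVec_mulVec, Matrix.mulVec_mulVec, ← hFE, hx]
      have hE : E.mulVec x = 0 := by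
        have := congrArg U.transpose.mulVec hy
        rwa [Matrix.mulVec_mulVec, hU, Matrix.one_mulVec, Matrix.mulVec_zero] at this
      funext k
      have := congrFun hE k
      simpa [E, Matrix.mulVec, dotProduct, Matrix.one_apply, Subtype.val_inj] using this
    intro x hx
    rw [Matrix.smul_mulVec, smul_eq_zero_iff_right Complex.I_ne_zero] at hx
    obtain ⟨h1, h2⟩ := toC_mulVec_eq_zero hx
    funext i
    exact Complex.ext (congrFun (hFreal _ h1) i) (congrFun (hFreal _ h2) i)

end Reduction

/-! ### Eigenvalue families -/

/-- The splitting of the indices `0, …, 2N - 1` into the first `r` and the remaining ones. -/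
def indexSplit {N r : ℕ} (hr : r ≤ N) : Fin r ⊕ Fin (2 * N - r) ≃ Fin (2 * N) :=
  finSumFinEquiv.trans (finCongr (by omega))

section Families

variable {N r : ℕ} (hr : r ≤ N)

lemma indexSplit_inl (i : Fin r) : (indexSplit hr (Sum.inl i) : ℕ) = i := by
  simp [indexSplit]

lemma indexSplit_inr (k : Fin (2 * N - r)) : (indexSplit hr (Sum.inr k) : ℕ) = r + k := by
  simp [indexSplit]

lemma prod_eq_prod_indexSplit {M : Type*} [CommMonoid M] (f : Fin (2 * N) → M) :
    ∏ j, f j = (∏ i, f (indexSplit hr (Sum.inl i))) * ∏ k, f (indexSplit hr (Sum.inr k)) := by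
  rw [← Equiv.prod_comp (indexSplit hr) f, Fintype.prod_sum_type]

variable {A : ℝ → Matrix (Fin N ⊕ Fin N) (Fin N ⊕ Fin N) ℂ}
  {W : Matrix (Fin r ⊕ Fin (2 * N - r)) (Fin r ⊕ Fin (2 * N - r)) ℂ} {δ : Fin r → ℝ}

lemma exists_isEigenvalueFamily (hr : r ≤ N) (hδ : ∀ i, δ i ≠ 0)
    (hA : ∀ β, (A β).charpoly = (blockOp W δ β).charpoly) :
    ∃ ζ : Fin (2 * N) → ℝ → ℂ, IsEigenvalueFamily A r ζ := by
  obtain ⟨w, hw⟩ := exists_eq_prod_X_sub_C (ι := Fin (2 * N - r))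
    (Matrix.charpoly_monic W.toBlocks₂₂) (Matrix.charpoly_natDegree_eq_dim _)
  obtain ⟨u, v, hu, hv, hfac⟩ := exists_blockOp_roots W hδ hw
  refine ⟨fun j β => Sum.elim (fun i => -(Complex.I * β) * u i β) (fun k => v k β)
    ((indexSplit hr).symm j), ?_, ?_, ?_⟩
  · filter_upwards [hfac] with β hβ
    rw [hA, hβ, prod_eq_prod_indexSplit hr]
    simp
  · intro j hj
    obtain ⟨i | k, rfl⟩ := (indexSplit hr).surjective j
    · simp only [IsHighLoss, Equiv.symm_apply_apply, Sum.elim_inl, norm_mul, norm_neg,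
        Complex.norm_I, one_mul, Complex.norm_real]
      refine Tendsto.atTop_mul_pos (C := ‖(δ i : ℂ)‖) ?_ tendsto_norm_atTop_atTop (hu i).norm
      simpa using hδ i
    · rw [indexSplit_inr] at hj
      omega
  · intro j hj
    obtain ⟨i | k, rfl⟩ := (indexSplit hr).surjective j
    · rw [indexSplit_inl] at hj
      omega
    · exact ⟨w k, by simpa using hv k⟩

lemma IsEigenvalueFamily.eventually_isRoot {ζ : Fin (2 * N) → ℝ → ℂ}
    (h : IsEigenvalueFamily A r ζ) (j : Fin (2 * N)) :
    ∀ᶠ β in atTop, (A β).charpoly.IsRoot (ζ j β) := by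
  filter_upwards [h.charpoly_eq] with β hβ
  rw [hβ, IsRoot.def, eval_prod]
  exact Finset.prod_eq_zero (Finset.mem_univ j) (by simp)

/-- The low-loss limits are real, and the number of nonzero ones is the rank of the lower right
block. -/
lemma IsEigenvalueFamily.exists_low_limits {ζ : Fin (2 * N) → ℝ → ℂ}
    (h : IsEigenvalueFamily A r ζ) (hδ : ∀ i, δ i ≠ 0) (hW : W.toBlocks₂₂.IsHermitian)
    (hA : ∀ β, (A β).charpoly = (blockOp W δ β).charpoly) :
    ∃ ρ : Fin (2 * N - r) → ℝ,
      (∀ k, Tendsto (ζ (indexSplit hr (Sum.inr k))) atTop (𝓝 (ρ k : ℂ))) ∧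
      Fintype.card {k // ρ k ≠ 0} = W.toBlocks₂₂.rank := by
  choose ρ hρ using fun k => h.low (indexSplit hr (Sum.inr k)) (by rw [indexSplit_inr]; omega)
  have hprod : ∏ k, (X - C (ρ k)) = W.toBlocks₂₂.charpoly := by
    refine prod_X_sub_C_low_limits_eq W hδ (f := fun i => ζ (indexSplit hr (Sum.inl i)))
      ?_ (fun i => h.high _ (by rw [indexSplit_inl]; exact i.2)) hρ
    filter_upwards [h.charpoly_eq] with β hβ
    rw [← hA, hβ, prod_eq_prod_indexSplit hr]
  -- Being Hermitian, the block has real eigenvalues, and its rank counts the nonzero ones.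
  rw [hW.charpoly_eq] at hprod
  obtain ⟨e, he⟩ := exists_equiv_of_prod_X_sub_C_eq hprod
  refine ⟨fun k => hW.eigenvalues (e k), fun k => ?_, ?_⟩
  · have := hρ k
    rw [← he k] at this
    exact this
  · rw [hW.rank_eq_card_non_zero_eigs]
    exact Fintype.card_congr (e.subtypeEquiv fun k => Iff.rfl)

lemma IsEigenvalueFamily.exists_refined_perm {ζ : Fin (2 * N) → ℝ → ℂ}
    (h : IsEigenvalueFamily A r ζ) {ρ : Fin (2 * N - r) → ℝ}
    (hρ : ∀ k, Tendsto (ζ (indexSplit hr (Sum.inr k))) atTop (𝓝 (ρ k : ℂ)))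
    (hcard : Fintype.card {k // ρ k ≠ 0} = 2 * (N - r)) :
    ∃ σ : Equiv.Perm (Fin (2 * N)), IsEigenvalueFamily A r (fun j => ζ (σ j)) ∧
      IsRefinedIndexing r (fun j => ζ (σ j)) := by
  -- The zero limits number `(2N - r) - 2(N - r) = r`.
  have hc1 : Fintype.card {k // ρ k = 0} = r := by
    have := Fintype.card_subtype_compl fun k => ρ k = 0
    have hle := Fintype.card_subtype_le fun k => ρ k = 0
    rw [Fintype.card_fin] at this hle
    change Fintype.card {k // ρ k ≠ 0} = _ at this
    omega
  have hc2 : Fintype.card {k : Fin (2 * N - r) // (k : ℕ) < r} = r := by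
    have : Fintype.card (Fin r) = Fintype.card {k : Fin (2 * N - r) // (k : ℕ) < r} :=
      Fintype.card_congr
        { toFun := fun i => ⟨⟨i, by omega⟩, i.2⟩
          invFun := fun k => ⟨k.1, k.2⟩
          left_inv := fun _ => rfl
          right_inv := fun _ => rfl }
    rw [← this, Fintype.card_fin]
  let e₀ : {k : Fin (2 * N - r) // (k : ℕ) < r} ≃ {k // ρ k = 0} :=
    Fintype.equivOfCardEq (hc2.trans hc1.symm)
  -- Any bijection from the first `r` low-loss indices to those with zero limit extends to a
  -- permutation, which then sends the other indices to nonzero limits.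
  let τ : Equiv.Perm (Fin (2 * N - r)) := e₀.extendSubtype
  let σ : Equiv.Perm (Fin (2 * N)) :=
    (indexSplit hr).symm.trans (((Equiv.refl _).sumCongr τ).trans (indexSplit hr))
  have hσl : ∀ i, σ (indexSplit hr (Sum.inl i)) = indexSplit hr (Sum.inl i) := by
    intro i
    simp [σ]
  have hσr : ∀ k, σ (indexSplit hr (Sum.inr k)) = indexSplit hr (Sum.inr (τ k)) := by
    intro k
    simp [σ]
  refine ⟨σ, ⟨?_, ?_, ?_⟩, ⟨?_, ?_⟩⟩
  · filter_upwards [h.charpoly_eq] with β hβ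
    rw [hβ, Equiv.prod_comp σ fun j => X - C (ζ j β)]
  · intro j hj
    obtain ⟨i | k, rfl⟩ := (indexSplit hr).surjective j
    · rw [hσl]
      exact h.high _ hj
    · rw [indexSplit_inr] at hj
      omega
  · intro j hj
    obtain ⟨i | k, rfl⟩ := (indexSplit hr).surjective j
    · rw [indexSplit_inl] at hj
      omega
    · rw [hσr]
      exact ⟨_, hρ _⟩
  · intro j hj1 hj2
    obtain ⟨i | k, rfl⟩ := (indexSplit hr).surjective j
    · rw [indexSplit_inl] at hj1
      omega
    · rw [indexSplit_inr] at hj2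
      have h0 : ρ (τ k) = 0 := e₀.extendSubtype_mem k (by omega)
      have := hρ (τ k)
      rw [h0, Complex.ofReal_zero] at this
      rw [hσr]
      exact this
  · intro j hj
    obtain ⟨i | k, rfl⟩ := (indexSplit hr).surjective j
    · rw [indexSplit_inl] at hj
      omega
    · rw [indexSplit_inr] at hj
      have h0 : ρ (τ k) ≠ 0 := e₀.extendSubtype_not_mem k (by omega)
      rw [hσr]
      exact ⟨_, by exact_mod_cast h0, hρ (τ k)⟩

end Families

end SelectiveOverdamping

open SelectiveOverdamping in
theorem mainTheorem1 {N : ℕ} (α η θ R : Matrix (Fin N) (Fin N) ℝ)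
    (hα : α.PosDef) (hη : η.PosSemidef) (hθ : θ.transpose = -θ) (hR : R.PosSemidef)
    (hrank : 0 < R.rank) (hgen : GenericCondition α R) :
    -- the eigenvalue functions exist
    (∃ ζ : Fin (2 * N) → ℝ → ℂ, IsEigenvalueFamily (systemOp α η θ R) R.rank ζ) ∧
    -- the high-loss eigenvalues are overdamped
    (∀ ζ : Fin (2 * N) → ℝ → ℂ, IsEigenvalueFamily (systemOp α η θ R) R.rank ζ →
      ∀ᶠ β in atTop, ∀ j : Fin (2 * N), (j : ℕ) < R.rank → (ζ j β).re = 0) ∧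
    -- the low-loss eigenvalues
    (LinearMap.ker R.mulVecLin ⊓ LinearMap.ker η.mulVecLin = ⊥ →
      ∀ ζ : Fin (2 * N) → ℝ → ℂ, IsEigenvalueFamily (systemOp α η θ R) R.rank ζ →
        -- they can be reindexed in the refined way
        (∃ σ : Equiv.Perm (Fin (2 * N)),
          IsEigenvalueFamily (systemOp α η θ R) R.rank (fun j => ζ (σ j)) ∧
          IsRefinedIndexing R.rank (fun j => ζ (σ j))) ∧
        -- and any such indexing has the asserted properties
        (IsRefinedIndexing R.rank ζ →
          (∀ᶠ β in atTop, ∀ j : Fin (2 * N), 2 * R.rank ≤ (j : ℕ) → (ζ j β).re ≠ 0) ∧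
          (∀ j : Fin (2 * N), R.rank ≤ (j : ℕ) → (j : ℕ) < 2 * R.rank →
            Tendsto (fun β => (ζ j β).re) atTop (𝓝 0)))) := by
  have hr : R.rank ≤ N := by simpa using R.rank_le_card_width
  obtain ⟨δ, W, hinj, hδ, hW, hA, hWrank⟩ := exists_blockOp_reduction hα hη hθ hR hgen
  refine ⟨exists_isEigenvalueFamily hr hδ hA, fun ζ hζ => ?_, fun hker ζ hζ => ?_⟩
  · simp only [eventually_all]
    intro j hj
    refine eventually_re_eq_zero_of_tendsto_norm W hδ hinj (fun β z hz => ?_) (hζ.high j hj) ?_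
    · rw [← hA] at hz ⊢
      exact isRoot_charpoly_systemOp_neg_conj β hz
    · simpa only [hA] using hζ.eventually_isRoot j
  · obtain ⟨ρ, hρ, hcard⟩ := hζ.exists_low_limits hr hδ hW hA
    refine ⟨hζ.exists_refined_perm hr hρ (hcard.trans (hWrank hker)), fun href => ⟨?_, ?_⟩⟩
    · simp only [eventually_all]
      intro j hj
      obtain ⟨ρ', hρ'0, hρ'⟩ := href.limit_ne_zero j hj
      obtain ⟨i | k, rfl⟩ := (indexSplit hr).surjective j
      · rw [indexSplit_inl] at hj
        omega
      · have hk : ρ k ≠ 0 := by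
          rintro h0
          apply hρ'0
          rw [tendsto_nhds_unique hρ' (hρ k), h0, Complex.ofReal_zero]
        -- The limit is real, so the real parts tend to the nonzero number `ρ k` itself.
        have hre := (Complex.continuous_re.tendsto _).comp (hρ k)
        rw [Complex.ofReal_re] at hre
        exact hre.eventually_ne hk
    · intro j hj1 hj2
      have := (Complex.continuous_re.tendsto _).comp (href.limit_zero j hj1 hj2)
      rwa [Complex.zero_re] at this
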